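/- Let $(X,d)$ be a finite metric space, $\beta\ge 1$ and $\Delta>0$. A probability distribution $\mathcal D$ over partitions of $X$ is a $(\beta,\Delta)$-Lipschitz decomposition of $X$ if every cluster of every partition in the support of $\mathcal D$ has diameter at most $\Delta$, and $\Pr_{P\sim\mathcal D}[P(x)\ne P(y)]\le \beta\, d(x,y)/\Delta$ for all $x,y\in X$, where $P(z)$ denotes the cluster of $P$ that contains $z$. For a metric space $M$ let $$\beta^*(M)=\inf\{\beta\ge 1:\ \text{for every } \Delta>0, \text{ every finite } M'\subseteq M \text{ admits a } (\beta,\Delta)\text{-Lipschitz decomposition}\}$$ (with $\inf\emptyset=\infty$), and for $n\ge 1$ let $$\beta^*_n(M)=\sup\{\beta^*(M'):\ M'\subseteq M,\ |M'|\le n\}.$$ **Corollary.** There is a universal constant $K>0$ such that for every $p\in[2,\infty)$ and every integer $n\ge 2$, $$\beta^*_n(\ell_p)\le K\,p^4\sqrt{\log n},$$ where $\ell_p$ is the space of real sequences $(x_i)_{i\in\mathbb N}$ with $\sum_i|x_i|^p<\infty$, with the metric induced by $\|x\|_p=(\sum_i |x_i|^p)^{1/p}$. -/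

import Mathlib

open scoped ENNReal

noncomputable section

/-- A probability distribution `D` over partitions of `X` is a `(β, Δ)`-Lipschitz decomposition.
A partition is given by its equivalence relation `P : Setoid X`, whose classes are the clusters, so
that `P(x) ≠ P(y)` reads `¬ P x y`. The notion is only used for finite `X`, where there are finitely
many partitions and `PMF (Setoid X)` is the type of all probability distributions over them. -/
def IsLipschitzDecomposition {X : Type*} [MetricSpace X] (β Δ : ℝ) (D : PMF (Setoid X)) : Prop :=
  (∀ P ∈ D.support, ∀ C ∈ P.classes, Metric.ediam C ≤ ENNReal.ofReal Δ) ∧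
    ∀ x y : X, D.toOuterMeasure {P : Setoid X | ¬ P x y} ≤ ENNReal.ofReal (β * (dist x y / Δ))

/-- `β` is admissible for `M`: `β ≥ 1` and, for all `Δ > 0`, every finite subset of `M` admits a
`(β, Δ)`-Lipschitz decomposition. -/
def IsAdmissibleDecompositionBound (M : Type*) [MetricSpace M] (β : ℝ) : Prop :=
  1 ≤ β ∧ ∀ Δ : ℝ, 0 < Δ → ∀ S : Set M, S.Finite →
    ∃ D : PMF (Setoid S), IsLipschitzDecomposition β Δ D

/-- The decomposition parameter `β*(M)`, with value `∞` if no `β` is admissible. -/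
def decompositionParameter (M : Type*) [MetricSpace M] : ℝ≥0∞ :=
  ⨅ (β : ℝ) (_ : IsAdmissibleDecompositionBound M β), ENNReal.ofReal β

/-- `β*_n(M)`, the supremum of `β*(M')` over all `M' ⊆ M` with at most `n` points. -/
def finiteDecompositionParameter (n : ℕ) (M : Type*) [MetricSpace M] : ℝ≥0∞ :=
  ⨆ (S : Set M) (_ : S.encard ≤ n), decompositionParameter S

end

/-! Euclidean case: put a Gaussian density at each suitably rescaled point and carve with random
superlevel sets `{i | τ < f i z}`. The separation probability is at most a constant times the total
variation distance, which is linear in the distance. Points at distance more than `Δ / 2` have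
overlap at most `1 / (2n)` once the scale is of order `√(log n) / Δ`, so by a union bound a
superlevel set rarely has diameter above `Δ`. Larger exponents reduce to 2 by Mazur maps `ℓ_p →
ℓ_{p/r}`, `1 < r ≤ 2`. These are Lipschitz only on balls, so `SeqDecomposable.of_mazur` descends
through the scales `2^m Δ`: each cluster at scale `2Δ` lies in a ball of radius `2Δ`, where the map
costs a constant, and the costs over all scales form a geometric series. A step with `r = 2`
multiplies the parameter by 16; about `log₂ p` of them give `16 ^ log₂ p = p ^ 4`. -/

/-! ### Random partitions by iterative carving. -/

/-- Merge all of `S` into one class and keep `P` outside of `S`. -/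
def Setoid.carve {ι : Type*} (S : Set ι) (P : Setoid ι) : Setoid ι where
  r i j := (i ∈ S ∧ j ∈ S) ∨ (i ∉ S ∧ j ∉ S ∧ P i j)
  iseqv :=
    { refl := fun i => by
        by_cases h : i ∈ S
        · exact Or.inl ⟨h, h⟩
        · exact Or.inr ⟨h, h, P.refl i⟩
      symm := by
        rintro i j (⟨h, h'⟩ | ⟨h, h', hP⟩)
        · exact Or.inl ⟨h', h⟩
        · exact Or.inr ⟨h', h, P.symm hP⟩
      trans := by
        rintro i j k (⟨h, h'⟩ | ⟨h, h', hP⟩) (⟨g, g'⟩ | ⟨g, g', gP⟩)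
        · exact Or.inl ⟨h, g'⟩
        · exact absurd h' g
        · exact absurd g h'
        · exact Or.inr ⟨h, g', P.trans hP gP⟩ }

theorem Setoid.carve_apply {ι : Type*} (S : Set ι) (P : Setoid ι) (i j : ι) :
    Setoid.carve S P i j ↔ (i ∈ S ∧ j ∈ S) ∨ (i ∉ S ∧ j ∉ S ∧ P i j) := Iff.rfl

theorem PMF.toOuterMeasure_le_one {α : Type*} (D : PMF α) (s : Set α) : D.toOuterMeasure s ≤ 1 := by
  rw [PMF.toOuterMeasure_apply, ← D.tsum_coe]
  exact ENNReal.tsum_le_tsum fun a => Set.indicator_le_self _ _ a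

open Classical in
/-- Iteratively removing random sets, distributed according to the weights `w`, partitions `ι`. -/
theorem exists_random_partition_of_weights {ι : Type*} [Finite ι] [Fintype (Set ι)]
    (w : Set ι → ℝ≥0∞) (R : ι → ι → Prop) (q : ι → ι → ℝ≥0∞)
    (hR : ∀ i, R i i) (hwR : ∀ S, w S ≠ 0 → ∀ i ∈ S, ∀ j ∈ S, R i j)
    (hpos : ∀ i, ∃ S, i ∈ S ∧ w S ≠ 0) (hfin : ∀ S, S.Nonempty → w S ≠ ∞)
    (hq : ∀ i j, (∑ S : Set ι with (i ∈ S ∧ j ∉ S) ∨ (j ∈ S ∧ i ∉ S), w S) ≤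
      q i j * ∑ S : Set ι with i ∈ S ∨ j ∈ S, w S) :
    ∃ D : PMF (Setoid ι), (∀ P ∈ D.support, ∀ i j, P i j → R i j) ∧
      ∀ i j, D.toOuterMeasure {P | ¬ P i j} ≤ q i j := by
  suffices H : ∀ T : Set ι, ∃ D : PMF (Setoid ι), (∀ P ∈ D.support, ∀ i j, P i j → R i j) ∧
      ∀ i ∈ T, ∀ j ∈ T, D.toOuterMeasure {P | ¬ P i j} ≤ q i j by
    obtain ⟨D, hD, hD'⟩ := H Set.univ
    exact ⟨D, hD, fun i j => hD' i trivial j trivial⟩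
  intro T
  induction h : T.ncard using Nat.strong_induction_on generalizing T with
  | _ m ih =>
  subst h
  rcases T.eq_empty_or_nonempty with rfl | ⟨t, ht⟩
  · refine ⟨PMF.pure ⊥, ?_, by simp⟩
    intro P hP i j hij
    rw [PMF.support_pure, Set.mem_singleton_iff] at hP
    subst hP
    rw [show i = j from hij]
    exact hR j
  have hrec : ∀ S : Set ι, ∃ D : PMF (Setoid ι), (∀ P ∈ D.support, ∀ i j, P i j → R i j) ∧
      ((S ∩ T).Nonempty → ∀ i ∈ T \ S, ∀ j ∈ T \ S, D.toOuterMeasure {P | ¬ P i j} ≤ q i j) := by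
    intro S
    by_cases hS : (S ∩ T).Nonempty
    · obtain ⟨k, hkS, hkT⟩ := hS
      obtain ⟨D, h1, h2⟩ := ih _ (Set.ncard_lt_ncard (s := T \ S) (t := T)
        ⟨Set.sdiff_subset, fun h => (h hkT).2 hkS⟩) _ rfl
      exact ⟨D, h1, fun _ => h2⟩
    · refine ⟨PMF.pure ⊥, ?_, fun h => absurd h hS⟩
      intro P hP i j hij
      rw [PMF.support_pure, Set.mem_singleton_iff] at hP
      subst hP
      rw [show i = j from hij]
      exact hR j
  choose E hE hE' using hrec
  -- Conditioning on meeting `T` makes the remaining set `T \ S` strictly smaller.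
  set v : Set ι → ℝ≥0∞ := fun S => if (S ∩ T).Nonempty then w S else 0 with hv
  have hv0 : ∑' S, v S ≠ 0 := by
    obtain ⟨S, hS, hw⟩ := hpos t
    intro h0
    have := (ENNReal.tsum_eq_zero.1 h0) S
    rw [hv] at this
    simp only at this
    rw [if_pos ⟨t, hS, ht⟩] at this
    exact hw this
  have hvtop : ∑' S, v S ≠ ∞ := by
    rw [tsum_fintype]
    refine ENNReal.sum_ne_top.2 fun S _ => ?_
    simp only [hv]
    split_ifs with h
    · exact hfin S (h.mono Set.inter_subset_left)
    · simp
  refine ⟨(PMF.normalize v hv0 hvtop).bind fun S => (E S).map (Setoid.carve S), ?_, ?_⟩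
  · intro P hP i j hij
    rw [PMF.mem_support_bind_iff] at hP
    obtain ⟨S, hS, hP⟩ := hP
    rw [PMF.mem_support_map_iff] at hP
    obtain ⟨Q, hQ, rfl⟩ := hP
    rw [PMF.mem_support_normalize_iff] at hS
    have hwS : w S ≠ 0 := by
      intro h
      apply hS
      simp [hv, h]
    rcases hij with ⟨h, h'⟩ | ⟨-, -, h⟩
    · exact hwR S hwS i h j h'
    · exact hE S Q hQ i j h
  · intro i hi j hj
    rw [PMF.toOuterMeasure_bind_apply]
    -- The first set meeting `{i, j}` decides: if it splits the pair, its whole weight is charged;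
    -- if it misses both, the induction hypothesis charges `q i j`.
    have key : ∀ S, (PMF.normalize v hv0 hvtop) S *
        ((E S).map (Setoid.carve S)).toOuterMeasure {P | ¬ P i j} ≤
        ((if (i ∈ S ∧ j ∉ S) ∨ (j ∈ S ∧ i ∉ S) then w S else 0) +
          q i j * (if i ∈ S ∨ j ∈ S then 0 else v S)) * (∑' S, v S)⁻¹ := by
      intro S
      rw [PMF.normalize_apply, mul_right_comm]
      gcongr
      rw [PMF.toOuterMeasure_map_apply]
      by_cases hiS : i ∈ S <;> by_cases hjS : j ∈ S
      · have : (Setoid.carve S ⁻¹' {P | ¬ P i j}) = ∅ := by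
          ext P; simp [Setoid.carve_apply, hiS, hjS]
        rw [this]; simp
      · simp only [hiS, hjS, not_false_eq_true, and_self, true_or, if_true, mul_zero, add_zero]
        calc _ ≤ v S * 1 := by gcongr; exact PMF.toOuterMeasure_le_one _ _
          _ ≤ w S := by simp only [hv]; split_ifs <;> simp
      · simp only [hiS, hjS, not_false_eq_true, and_self, or_true, if_true, mul_zero, add_zero]
        calc _ ≤ v S * 1 := by gcongr; exact PMF.toOuterMeasure_le_one _ _
          _ ≤ w S := by simp only [hv]; split_ifs <;> simp
      · have : (Setoid.carve S ⁻¹' {P | ¬ P i j}) = {P | ¬ P i j} := by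
          ext P; simp [Setoid.carve_apply, hiS, hjS]
        rw [this]
        simp only [hiS, hjS, false_and, or_self, if_false, zero_add]
        rw [mul_comm]
        by_cases hS : (S ∩ T).Nonempty
        · gcongr
          exact hE' S hS i ⟨hi, hiS⟩ j ⟨hj, hjS⟩
        · simp [hv, hS]
    refine (ENNReal.tsum_le_tsum key).trans ?_
    rw [ENNReal.tsum_mul_right, ENNReal.tsum_add, ENNReal.tsum_mul_left, ← div_eq_mul_inv]
    refine ENNReal.div_le_of_le_mul ?_
    simp only [tsum_fintype]
    rw [← Finset.sum_filter]
    calc _ ≤ q i j * (∑ S : Set ι with i ∈ S ∨ j ∈ S, w S) +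
          q i j * ∑ S, (if i ∈ S ∨ j ∈ S then 0 else v S) := by gcongr; exact hq i j
      _ = q i j * ∑ S, v S := by
        rw [← mul_add, Finset.sum_filter, ← Finset.sum_add_distrib]
        congr 1
        refine Finset.sum_congr rfl fun S _ => ?_
        by_cases h : i ∈ S ∨ j ∈ S
        · have : (S ∩ T).Nonempty := by
            rcases h with h | h
            exacts [⟨i, h, hi⟩, ⟨j, h, hj⟩]
          simp [h, hv, this]
        · simp [h]

open MeasureTheory in
/-- Carving with the random set `A`. -/
theorem exists_random_partition_of_random_set {ι Ω : Type*} [Finite ι] [MeasurableSpace Ω]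
    (μ : Measure Ω) (A : Ω → Set ι) (R : ι → ι → Prop) (q : ι → ι → ℝ≥0∞)
    (hA : ∀ i, MeasurableSet {ω | i ∈ A ω})
    (hR : ∀ i, R i i) (hAR : ∀ ω, ∀ i ∈ A ω, ∀ j ∈ A ω, R i j)
    (hpos : ∀ i, μ {ω | i ∈ A ω} ≠ 0) (hfin : ∀ i, μ {ω | i ∈ A ω} ≠ ∞)
    (hq : ∀ i j, μ {ω | i ∈ A ω ∧ j ∉ A ω} + μ {ω | j ∈ A ω ∧ i ∉ A ω} ≤
      q i j * μ {ω | i ∈ A ω}) :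
    ∃ D : PMF (Setoid ι), (∀ P ∈ D.support, ∀ i j, P i j → R i j) ∧
      ∀ i j, D.toOuterMeasure {P | ¬ P i j} ≤ q i j := by
  classical
  have := Fintype.ofFinite (Set ι)
  have hA1 : ∀ S, MeasurableSet (A ⁻¹' {S}) := by
    intro S
    have : A ⁻¹' {S} = ⋂ i, {ω | i ∈ A ω ↔ i ∈ S} := by
      ext ω
      simp [Set.ext_iff]
    rw [this]
    refine MeasurableSet.iInter fun i => ?_
    by_cases h : i ∈ S
    · simpa [h] using hA i
    · simp only [h, iff_false]
      exact (hA i).compl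
  have hsum : ∀ (p : Set ι → Prop) [DecidablePred p],
      ∑ S : Set ι with p S, μ (A ⁻¹' {S}) = μ {ω | p (A ω)} := by
    intro p _
    rw [sum_measure_preimage_singleton _ fun S _ => hA1 S]
    congr 1
    ext ω
    simp
  refine exists_random_partition_of_weights (fun S => μ (A ⁻¹' {S})) R q hR ?_ ?_ ?_ ?_
  · intro S hS i hi j hj
    obtain ⟨ω, hω⟩ := nonempty_of_measure_ne_zero hS
    have hω : A ω = S := hω
    subst hω
    exact hAR ω i hi j hj
  · intro i
    by_contra! h
    apply hpos i
    rw [← hsum (fun S => i ∈ S)]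
    exact Finset.sum_eq_zero fun S hS => h S (Finset.mem_filter.1 hS).2
  · rintro S ⟨i, hi⟩
    refine ne_top_of_le_ne_top (hfin i) (measure_mono ?_)
    intro ω hω
    have hω : A ω = S := hω
    subst hω
    exact hi
  · intro i j
    rw [hsum (fun S => (i ∈ S ∧ j ∉ S) ∨ (j ∈ S ∧ i ∉ S)), hsum (fun S => i ∈ S ∨ j ∈ S)]
    calc _ ≤ μ {ω | i ∈ A ω ∧ j ∉ A ω} + μ {ω | j ∈ A ω ∧ i ∉ A ω} := measure_union_le _ _
      _ ≤ q i j * μ {ω | i ∈ A ω} := hq i j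
      _ ≤ _ := by gcongr; tauto

open MeasureTheory in
/-- Carving with random superlevel sets of a family of probability densities: the separation
probability is controlled by the total variation distances, provided that the densities of far
apart points have little overlap. -/
theorem exists_random_partition_of_densities {ι Z : Type*} [Fintype ι] [MeasurableSpace Z]
    (μ : Measure Z) [SFinite μ] (f : ι → Z → ℝ) (hf : ∀ i, Measurable (f i))
    (hf1 : ∀ i, ∫⁻ z, ENNReal.ofReal (f i z) ∂μ = 1) (R' R : ι → ι → Prop)
    (hR : ∀ i, R i i) (hR' : ∀ i j k, R' i j → R' i k → R j k)
    (hsmall : ∀ i j, ¬ R' i j →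
      ∫⁻ z, ENNReal.ofReal (min (f i z) (f j z)) ∂μ ≤ (2 * (Fintype.card ι : ℝ≥0∞))⁻¹) :
    ∃ D : PMF (Setoid ι), (∀ P ∈ D.support, ∀ i j, P i j → R i j) ∧
      ∀ i j, D.toOuterMeasure {P | ¬ P i j} ≤
        2 * (∫⁻ z, ENNReal.ofReal (f i z - f j z) ∂μ + ∫⁻ z, ENNReal.ofReal (f j z - f i z) ∂μ) := by
  classical
  set B : Z × ℝ → Set ι := fun ω => {i | 0 < ω.2 ∧ ω.2 < f i ω.1} with hB
  -- `A ω` is `B ω` when that set is small in the sense of `R`, and empty otherwise.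
  set A : Z × ℝ → Set ι := fun ω => {i | i ∈ B ω ∧ ∀ j ∈ B ω, ∀ k ∈ B ω, R j k} with hA
  set ν := μ.prod (volume : Measure ℝ) with hν
  have mB : ∀ i, MeasurableSet {ω | i ∈ B ω} := fun i =>
    (measurableSet_lt measurable_const measurable_snd).inter
      (measurableSet_lt measurable_snd ((hf i).comp measurable_fst))
  have mA : ∀ i, MeasurableSet {ω | i ∈ A ω} := by
    intro i
    refine (mB i).inter (s₂ := {ω | ∀ j ∈ B ω, ∀ k ∈ B ω, R j k}) ?_
    have : {ω | ∀ j ∈ B ω, ∀ k ∈ B ω, R j k} =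
        ⋂ j, ⋂ k, ({ω | j ∈ B ω}ᶜ ∪ ({ω | k ∈ B ω}ᶜ ∪ {_ω | R j k})) := by
      ext ω
      simp only [Set.mem_ofPred_eq, Set.mem_iInter, Set.mem_union, Set.mem_compl_iff]
      grind
    rw [this]
    exact MeasurableSet.iInter fun j => MeasurableSet.iInter fun k =>
      (mB j).compl.union ((mB k).compl.union (MeasurableSet.const _))
  have νB : ∀ i, ν {ω | i ∈ B ω} = 1 := by
    intro i
    rw [hν, Measure.prod_apply (mB i), ← hf1 i]
    refine lintegral_congr fun z => ?_
    have : Prod.mk z ⁻¹' {ω | i ∈ B ω} = Set.Ioo 0 (f i z) := rfl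
    rw [this, Real.volume_Ioo, sub_zero]
  have νBB : ∀ i j, ν ({ω | i ∈ B ω} ∩ {ω | j ∈ B ω}) =
      ∫⁻ z, ENNReal.ofReal (min (f i z) (f j z)) ∂μ := by
    intro i j
    rw [hν, Measure.prod_apply ((mB i).inter (mB j))]
    refine lintegral_congr fun z => ?_
    have : Prod.mk z ⁻¹' ({ω | i ∈ B ω} ∩ {ω | j ∈ B ω}) = Set.Ioo 0 (min (f i z) (f j z)) := by
      ext τ
      simp only [hB, Set.mem_preimage, Set.mem_inter_iff, Set.mem_ofPred_eq, Set.mem_Ioo, lt_min_iff]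
      tauto
    rw [this, Real.volume_Ioo, sub_zero]
  have νdiff : ∀ i j, ν {ω | i ∈ A ω ∧ j ∉ A ω} ≤ ∫⁻ z, ENNReal.ofReal (f i z - f j z) ∂μ := by
    intro i j
    calc ν {ω | i ∈ A ω ∧ j ∉ A ω} ≤ ν ({ω | i ∈ B ω} \ {ω | j ∈ B ω}) := by
          refine measure_mono fun ω hω => ⟨hω.1.1, fun hj => hω.2 ⟨hj, hω.1.2⟩⟩
      _ ≤ _ := by
        rw [hν, Measure.prod_apply ((mB i).diff (mB j))]
        refine lintegral_mono fun z => ?_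
        rw [← Real.volume_Ico]
        refine measure_mono fun τ hτ => ?_
        simp only [hB, Set.mem_preimage, Set.mem_sdiff, Set.mem_ofPred_eq, not_and, not_lt] at hτ
        exact ⟨hτ.2 hτ.1.1, hτ.1.2⟩
  have νA : ∀ i, 2⁻¹ ≤ ν {ω | i ∈ A ω} := by
    intro i
    -- If `i` lies in `B` but `B` is rejected, then by `hR'` some `j ∈ B` is not `R'`-close to `i`;
    -- the overlaps with such `j` sum to at most 1/2.
    have hsub : {ω | i ∈ B ω} ⊆ {ω | i ∈ A ω} ∪
        ⋃ j ∈ (Finset.univ.filter fun j => ¬ R' i j), ({ω | i ∈ B ω} ∩ {ω | j ∈ B ω}) := by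
      intro ω hω
      by_cases h : i ∈ A ω
      · exact Or.inl h
      · right
        have : ∃ j ∈ B ω, ¬ R' i j := by
          by_contra! hc
          exact h ⟨hω, fun j hj k hk => hR' i j k (hc j hj) (hc k hk)⟩
        obtain ⟨j, hj, hij⟩ := this
        simp only [Set.mem_iUnion]
        exact ⟨j, by simpa using hij, hω, hj⟩
    have h1 := (measure_mono hsub).trans ((measure_union_le (μ := ν) _ _).trans
      (add_le_add_right (measure_biUnion_finset_le _ _) _))
    rw [νB] at h1
    have h2 : ∑ j ∈ (Finset.univ.filter fun j => ¬ R' i j),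
        ν ({ω | i ∈ B ω} ∩ {ω | j ∈ B ω}) ≤ 2⁻¹ := by
      calc _ ≤ ∑ j ∈ (Finset.univ.filter fun j => ¬ R' i j), (2 * (Fintype.card ι : ℝ≥0∞))⁻¹ := by
            refine Finset.sum_le_sum fun j hj => ?_
            rw [νBB]
            exact hsmall i j (Finset.mem_filter.1 hj).2
        _ ≤ ∑ j : ι, (2 * (Fintype.card ι : ℝ≥0∞))⁻¹ :=
            Finset.sum_le_sum_of_subset (Finset.filter_subset _ _)
        _ = 2⁻¹ := by
          have hne : (Fintype.card ι : ℝ≥0∞) ≠ 0 := by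
            have : Nonempty ι := ⟨i⟩
            exact_mod_cast Fintype.card_ne_zero
          rw [Finset.sum_const, Finset.card_univ, nsmul_eq_mul,
            ENNReal.mul_inv (by simp) (by simp), mul_left_comm,
            ENNReal.mul_inv_cancel hne (by simp), mul_one]
    by_contra! hlt
    have := h1.trans (add_le_add_right h2 _)
    have h3 : ν {ω | i ∈ A ω} + 2⁻¹ < 2⁻¹ + 2⁻¹ := ENNReal.add_lt_add_right (by simp) hlt
    rw [ENNReal.inv_two_add_inv_two] at h3
    exact absurd (lt_of_le_of_lt this h3) (lt_irrefl _)
  refine exists_random_partition_of_random_set ν A R _ mA hR ?_ ?_ ?_ ?_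
  · intro ω i hi j hj
    exact hi.2 i hi.1 j hj.1
  · intro i h
    have := νA i
    rw [h] at this
    simp at this
  · intro i
    refine ne_top_of_le_ne_top ENNReal.one_ne_top ((measure_mono fun ω hω => ?_).trans (νB i).le)
    exact hω.1
  · intro i j
    refine (add_le_add (νdiff i j) (νdiff j i)).trans ?_
    calc _ = 2 * (∫⁻ z, ENNReal.ofReal (f i z - f j z) ∂μ +
            ∫⁻ z, ENNReal.ofReal (f j z - f i z) ∂μ) * 2⁻¹ := by
          rw [mul_right_comm, ENNReal.mul_inv_cancel (by simp) (by simp), one_mul]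
      _ ≤ _ := by gcongr; exact νA i

/-! ### Overlap and total variation of Gaussian densities. -/

section Gaussian

open MeasureTheory

variable {E : Type*} [NormedAddCommGroup E] [InnerProductSpace ℝ E]

/-- The density of the standard Gaussian distribution centered at `a`. -/
noncomputable def gaussianDensity (a z : E) : ℝ :=
  (2 * Real.pi) ^ (-(Module.finrank ℝ E : ℝ) / 2) * Real.exp (-(1 / 2) * ‖z - a‖ ^ 2)

theorem gaussianDensity_nonneg (a z : E) : 0 ≤ gaussianDensity a z := by
  unfold gaussianDensity; positivity

/-- By the parallelogram law, the geometric mean of two Gaussians is a multiple of the Gaussian at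
the midpoint; the factor is their Hellinger affinity. -/
theorem sqrt_gaussianDensity_mul (a b z : E) :
    Real.sqrt (gaussianDensity a z) * Real.sqrt (gaussianDensity b z) =
      Real.exp (-‖a - b‖ ^ 2 / 8) * gaussianDensity ((1 / 2 : ℝ) • (a + b)) z := by
  rw [← Real.sqrt_mul (gaussianDensity_nonneg a z)]
  rw [Real.sqrt_eq_iff_mul_self_eq (mul_nonneg (gaussianDensity_nonneg a z)
    (gaussianDensity_nonneg b z)) (mul_nonneg (Real.exp_nonneg _) (gaussianDensity_nonneg _ z))]
  unfold gaussianDensity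
  have h : ‖z - a‖ ^ 2 + ‖z - b‖ ^ 2 =
      2 * ‖z - (1 / 2 : ℝ) • (a + b)‖ ^ 2 + ‖a - b‖ ^ 2 / 2 := by
    have := parallelogram_law_with_norm ℝ (z - a) (z - b)
    rw [show z - a + (z - b) = (2 : ℝ) • (z - (1 / 2 : ℝ) • (a + b)) by module,
      show z - a - (z - b) = b - a by abel, norm_smul, norm_sub_rev b a] at this
    norm_num at this ⊢
    nlinarith
  have h2 : Real.exp (-(1 / 2) * ‖z - a‖ ^ 2) * Real.exp (-(1 / 2) * ‖z - b‖ ^ 2) =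
      (Real.exp (-‖a - b‖ ^ 2 / 8) *
        Real.exp (-(1 / 2) * ‖z - (1 / 2 : ℝ) • (a + b)‖ ^ 2)) ^ 2 := by
    rw [← Real.exp_add, ← Real.exp_add, ← Real.exp_nat_mul]
    congr 1
    push_cast
    linarith
  linear_combination (((2 * Real.pi) ^ (-(Module.finrank ℝ E : ℝ) / 2)) ^ 2) * h2

variable [MeasurableSpace E] [BorelSpace E]

theorem measurable_gaussianDensity (a : E) : Measurable (gaussianDensity a) := by
  have : Continuous (gaussianDensity a) := by unfold gaussianDensity; fun_prop
  exact this.measurable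

variable [FiniteDimensional ℝ E]

theorem integral_gaussianDensity (a : E) : ∫ z, gaussianDensity a z = 1 := by
  unfold gaussianDensity
  rw [integral_const_mul, integral_sub_right_eq_self (fun z : E => Real.exp (-(1 / 2) * ‖z‖ ^ 2)) a,
    GaussianFourier.integral_rexp_neg_mul_sq_norm (by norm_num),
    show Real.pi / (1 / 2) = 2 * Real.pi by ring, ← Real.rpow_add (by positivity)]
  rw [neg_div, neg_add_cancel, Real.rpow_zero]

theorem integrable_gaussianDensity (a : E) : Integrable (gaussianDensity a) := by
  by_contra h
  have := integral_gaussianDensity a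
  rw [integral_undef h] at this
  exact zero_ne_one this

theorem lintegral_gaussianDensity (a : E) :
    ∫⁻ z, ENNReal.ofReal (gaussianDensity a z) = 1 := by
  rw [← ofReal_integral_eq_lintegral_ofReal (integrable_gaussianDensity a)
    (Filter.Eventually.of_forall (gaussianDensity_nonneg a)), integral_gaussianDensity]
  simp

/-- The minimum is at most the geometric mean. -/
theorem lintegral_min_gaussianDensity_le (a b : E) :
    ∫⁻ z, ENNReal.ofReal (min (gaussianDensity a z) (gaussianDensity b z)) ≤
      ENNReal.ofReal (Real.exp (-‖a - b‖ ^ 2 / 8)) := by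
  calc _ ≤ ∫⁻ z, ENNReal.ofReal (Real.exp (-‖a - b‖ ^ 2 / 8)) *
        ENNReal.ofReal (gaussianDensity ((1 / 2 : ℝ) • (a + b)) z) := by
        refine lintegral_mono fun z => ?_
        rw [← ENNReal.ofReal_mul (Real.exp_nonneg _), ← sqrt_gaussianDensity_mul]
        refine ENNReal.ofReal_le_ofReal ?_
        have ha := gaussianDensity_nonneg a z
        have hb := gaussianDensity_nonneg b z
        rw [← Real.sqrt_mul ha]
        refine Real.le_sqrt_of_sq_le ?_
        rw [sq]
        exact mul_le_mul (min_le_left _ _) (min_le_right _ _) (le_min ha hb) ha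
    _ = _ := by
      rw [lintegral_const_mul _ (measurable_gaussianDensity _).ennreal_ofReal,
        lintegral_gaussianDensity, mul_one]

/-- With `u`, `v` the square roots of the densities and `d = ‖a - b‖`, AM-GM gives `u² - v² ≤
(2/d)(u - v)² + (d/8)(u + v)²`. The integrals of the two squares are `2 - 2κ ≤ d²/4` and `2 + 2κ ≤
4`, so each term contributes at most `d/2`. -/
theorem lintegral_gaussianDensity_sub_le (a b : E) :
    ∫⁻ z, ENNReal.ofReal (gaussianDensity a z - gaussianDensity b z) ≤
      ENNReal.ofReal ‖a - b‖ := by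
  rcases eq_or_ne a b with rfl | hab
  · simp
  have hd : 0 < ‖a - b‖ := norm_pos_iff.2 (sub_ne_zero.2 hab)
  set d := ‖a - b‖ with hd_def
  set m := (1 / 2 : ℝ) • (a + b) with hm
  set κ := Real.exp (-d ^ 2 / 8) with hκ
  have hκ1 : κ ≤ 1 := Real.exp_le_one_iff.2 (by nlinarith)
  have hκ2 : 1 - d ^ 2 / 8 ≤ κ := by
    have := Real.add_one_le_exp (-d ^ 2 / 8)
    linarith
  set g : E → ℝ := fun z => (2 / d) * (gaussianDensity a z + gaussianDensity b z -
      2 * (κ * gaussianDensity m z)) + (d / 8) * (gaussianDensity a z + gaussianDensity b z +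
      2 * (κ * gaussianDensity m z)) with hg
  have hia := integrable_gaussianDensity a
  have hib := integrable_gaussianDensity b
  have hab' : Integrable fun z => gaussianDensity a z + gaussianDensity b z := hia.add hib
  have him := ((integrable_gaussianDensity m).const_mul κ).const_mul 2
  have hsub : Integrable fun z => (2 / d) * (gaussianDensity a z + gaussianDensity b z -
      2 * (κ * gaussianDensity m z)) := (hab'.sub him).const_mul _
  have hadd : Integrable fun z => (d / 8) * (gaussianDensity a z + gaussianDensity b z +
      2 * (κ * gaussianDensity m z)) := (hab'.add him).const_mul _
  have hgint : Integrable g := hsub.add hadd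
  have hle : ∀ z, gaussianDensity a z - gaussianDensity b z ≤ g z := by
    intro z
    have h := sqrt_gaussianDensity_mul a b z
    simp only [hg, hκ, hd_def, hm]
    rw [← h]
    have ha := Real.sq_sqrt (gaussianDensity_nonneg a z)
    have hb := Real.sq_sqrt (gaussianDensity_nonneg b z)
    set u := √(gaussianDensity a z)
    set v := √(gaussianDensity b z)
    rw [← ha, ← hb, ← hd_def]
    have h3 : (2 / d) * (u ^ 2 + v ^ 2 - 2 * (u * v)) + (d / 8) * (u ^ 2 + v ^ 2 + 2 * (u * v)) -
        (u ^ 2 - v ^ 2) = (2 / d) * ((u - v) - (d / 4) * (u + v)) ^ 2 := by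
      field_simp
      ring
    have : 0 ≤ (2 / d) * ((u - v) - (d / 4) * (u + v)) ^ 2 := by positivity
    linarith
  have hg0 : ∀ z, 0 ≤ g z := by
    intro z
    have h := sqrt_gaussianDensity_mul a b z
    simp only [hg, hκ, hd_def, hm]
    rw [← h]
    have ha := Real.sq_sqrt (gaussianDensity_nonneg a z)
    have hb := Real.sq_sqrt (gaussianDensity_nonneg b z)
    set u := √(gaussianDensity a z)
    set v := √(gaussianDensity b z)
    rw [← ha, ← hb, ← hd_def]
    have h3 : (2 / d) * (u ^ 2 + v ^ 2 - 2 * (u * v)) + (d / 8) * (u ^ 2 + v ^ 2 + 2 * (u * v)) =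
        (2 / d) * (u - v) ^ 2 + (d / 8) * (u + v) ^ 2 := by ring
    rw [h3]
    positivity
  calc _ ≤ ∫⁻ z, ENNReal.ofReal (g z) :=
        lintegral_mono fun z => ENNReal.ofReal_le_ofReal (hle z)
    _ = ENNReal.ofReal (∫ z, g z) :=
        (ofReal_integral_eq_lintegral_ofReal hgint (Filter.Eventually.of_forall hg0)).symm
    _ ≤ _ := by
      refine ENNReal.ofReal_le_ofReal ?_
      have : ∫ z, g z = (2 / d) * (1 + 1 - 2 * (κ * 1)) + (d / 8) * (1 + 1 + 2 * (κ * 1)) := by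
        rw [hg, integral_add hsub hadd, integral_const_mul, integral_const_mul,
          integral_sub hab' him, integral_add hab' him, integral_add hia hib,
          integral_const_mul, integral_const_mul]
        simp only [integral_gaussianDensity]
      rw [this]
      have h4 : (2 / d) * (1 + 1 - 2 * (κ * 1)) ≤ (2 / d) * (d ^ 2 / 4) := by
        gcongr
        linarith
      have h5 : (2 / d) * (d ^ 2 / 4) = d / 2 := by field_simp; norm_num
      nlinarith

end Gaussian

/-! ### Decomposition of Euclidean spaces. -/

/-- `n`-point subsets of a Euclidean space have a Lipschitz decomposition with parameter
`O(√(log n))`. -/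
theorem exists_random_partition_euclidean {ι E : Type*} [Fintype ι] [NormedAddCommGroup E]
    [InnerProductSpace ℝ E] [FiniteDimensional ℝ E] {n : ℕ} (hn : 2 ≤ n)
    (hι : Fintype.card ι ≤ n) (x : ι → E) {Δ : ℝ} (hΔ : 0 < Δ) :
    ∃ D : PMF (Setoid ι), (∀ P ∈ D.support, ∀ i j, P i j → ‖x i - x j‖ ≤ Δ) ∧
      ∀ i j, D.toOuterMeasure {P | ¬ P i j} ≤
        ENNReal.ofReal (32 * √(Real.log n) * (‖x i - x j‖ / Δ)) := by
  borelize E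
  have hn2 : (2 : ℝ) ≤ n := by exact_mod_cast hn
  have hlog : 0 ≤ Real.log n := Real.log_nonneg (by linarith)
  -- Distance `Δ / 2` becomes `4 √(log n)`, so the overlap is at most `exp (-2 log n) = n⁻² ≤
  -- (2n)⁻¹`.
  set s : ℝ := 8 * √(Real.log n) / Δ with hs
  have hs0 : 0 ≤ s := by positivity
  have hnorm : ∀ i j, ‖s • x i - s • x j‖ = s * ‖x i - x j‖ := by
    intro i j
    rw [← smul_sub, norm_smul, Real.norm_of_nonneg hs0]
  obtain ⟨D, hD, hD'⟩ := exists_random_partition_of_densities (MeasureTheory.volume : _)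
    (fun i => gaussianDensity (s • x i)) (fun i => measurable_gaussianDensity _)
    (fun i => lintegral_gaussianDensity _) (fun i j => ‖x i - x j‖ ≤ Δ / 2)
    (fun i j => ‖x i - x j‖ ≤ Δ) (fun i => by simpa using hΔ.le) (by
      intro i j k hij hik
      calc ‖x j - x k‖ = ‖(x i - x k) - (x i - x j)‖ := by congr 1; abel
        _ ≤ ‖x i - x k‖ + ‖x i - x j‖ := norm_sub_le _ _
        _ ≤ Δ := by linarith) (by
      intro i j hij
      refine (lintegral_min_gaussianDensity_le _ _).trans ?_
      rw [hnorm]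
      push Not at hij
      have h1 : s * (Δ / 2) = 4 * √(Real.log n) := by
        rw [hs]; field_simp; ring
      have h2 : 16 * Real.log n ≤ (s * ‖x i - x j‖) ^ 2 := by
        calc 16 * Real.log n = (s * (Δ / 2)) ^ 2 := by
              rw [h1, mul_pow, Real.sq_sqrt hlog]; norm_num
          _ ≤ _ := by gcongr
      have h3 : Real.exp (-(s * ‖x i - x j‖) ^ 2 / 8) ≤ (2 * (n : ℝ))⁻¹ := by
        calc _ ≤ Real.exp (-(Real.log n + Real.log n)) := Real.exp_le_exp.2 (by linarith)
          _ = ((n : ℝ) * n)⁻¹ := by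
            rw [Real.exp_neg, Real.exp_add, Real.exp_log (by linarith)]
          _ ≤ _ := by gcongr
      refine (ENNReal.ofReal_le_ofReal h3).trans ?_
      rw [ENNReal.ofReal_inv_of_pos (by linarith), ENNReal.ofReal_mul (by norm_num),
        ENNReal.ofReal_natCast, ENNReal.ofReal_ofNat]
      gcongr)
  refine ⟨D, hD, fun i j => (hD' i j).trans ?_⟩
  have h1 := lintegral_gaussianDensity_sub_le (s • x i) (s • x j)
  have h2 := lintegral_gaussianDensity_sub_le (s • x j) (s • x i)
  rw [hnorm] at h1 h2
  rw [norm_sub_rev] at h2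
  calc _ ≤ 2 * (ENNReal.ofReal (s * ‖x i - x j‖) + ENNReal.ofReal (s * ‖x i - x j‖)) := by
        gcongr
    _ = ENNReal.ofReal (2 * (s * ‖x i - x j‖ + s * ‖x i - x j‖)) := by
      rw [ENNReal.ofReal_mul zero_le_two, ENNReal.ofReal_add (by positivity) (by positivity),
        ENNReal.ofReal_ofNat]
    _ = _ := by
      congr 1
      rw [hs]; ring

/-! ### Decomposability of sequence families, and the exponent 2. -/

/-- The `ℓ_p` distance of two real sequences. -/
noncomputable def seqDist (p : ℝ) (a b : ℕ → ℝ) : ℝ := (∑' k, |a k - b k| ^ p) ^ (1 / p)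

theorem seqDist_nonneg (p : ℝ) (a b : ℕ → ℝ) : 0 ≤ seqDist p a b :=
  Real.rpow_nonneg (tsum_nonneg fun _ => by positivity) _

/-- Every family of at most `n` sequences in `ℓ_p` has, at every scale, a Lipschitz decomposition
with parameter `β`. -/
def SeqDecomposable (p : ℝ) (n : ℕ) (β : ℝ) : Prop :=
  ∀ (ι : Type) [Fintype ι], Fintype.card ι ≤ n → ∀ x : ι → ℕ → ℝ,
    (∀ i, Summable fun k => |x i k| ^ p) → ∀ Δ : ℝ, 0 < Δ →
    ∃ D : PMF (Setoid ι), (∀ P ∈ D.support, ∀ i j, P i j → seqDist p (x i) (x j) ≤ Δ) ∧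
      ∀ i j, D.toOuterMeasure {P | ¬ P i j} ≤
        ENNReal.ofReal (β * (seqDist p (x i) (x j) / Δ))

theorem lp.norm_sub_eq_seqDist {p : ℝ≥0∞} (hp : 0 < p.toReal) (a b : lp (fun _ : ℕ => ℝ) p) :
    ‖a - b‖ = seqDist p.toReal a b := by
  rw [lp.norm_eq_tsum_rpow hp]
  rfl

/-- The points span a finite-dimensional subspace of `ℓ_2`, where Gaussian densities are available.
-/
theorem seqDecomposable_two {n : ℕ} (hn : 2 ≤ n) :
    SeqDecomposable 2 n (32 * √(Real.log n)) := by
  intro ι _ hι x hx Δ hΔ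
  let y : ι → lp (fun _ : ℕ => ℝ) 2 := fun i => ⟨x i, memℓp_gen (by simpa using hx i)⟩
  let V := Submodule.span ℝ (Set.range y)
  have : FiniteDimensional ℝ V := FiniteDimensional.span_of_finite ℝ (Set.finite_range y)
  let z : ι → V := fun i => ⟨y i, Submodule.subset_span ⟨i, rfl⟩⟩
  have hz : ∀ i j, ‖z i - z j‖ = seqDist 2 (x i) (x j) := by
    intro i j
    have := lp.norm_sub_eq_seqDist (p := 2) (by norm_num) (y i) (y j)
    rw [ENNReal.toReal_ofNat] at this
    exact this
  obtain ⟨D, h1, h2⟩ := exists_random_partition_euclidean hn hι z hΔ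
  simp only [hz] at h1 h2
  exact ⟨D, h1, h2⟩

theorem summable_abs_sub_rpow {p : ℝ} (hp : 1 ≤ p) {a b : ℕ → ℝ}
    (ha : Summable fun k => |a k| ^ p) (hb : Summable fun k => |b k| ^ p) :
    Summable fun k => |a k - b k| ^ p := by
  refine Summable.of_nonneg_of_le (fun k => by positivity) (fun k => ?_)
    (Real.summable_Lp_add_of_nonneg hp (fun k => abs_nonneg (a k)) (fun k => abs_nonneg (b k)) ha hb)
  gcongr
  exact abs_sub _ _

/-! ### Estimates for Mazur maps. -/

/-- The Mazur map `a ↦ sign a |a|^r`. -/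
noncomputable def mazur (r a : ℝ) : ℝ := SignType.sign a * |a| ^ r

theorem mazur_of_nonneg {r a : ℝ} (hr : 0 < r) (ha : 0 ≤ a) : mazur r a = a ^ r := by
  rcases ha.eq_or_lt with rfl | h
  · simp [mazur, Real.zero_rpow hr.ne']
  · simp [mazur, sign_pos h, abs_of_pos h]

theorem mazur_neg (r a : ℝ) : mazur r (-a) = -mazur r a := by
  simp [mazur, Left.sign_neg]

theorem abs_mazur {r : ℝ} (hr : 0 < r) (a : ℝ) : |mazur r a| = |a| ^ r := by
  rcases le_total 0 a with h | h
  · rw [mazur_of_nonneg hr h, abs_of_nonneg (by positivity), abs_of_nonneg h]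
  · rw [← neg_neg a, mazur_neg, abs_neg, mazur_of_nonneg hr (by linarith),
      abs_of_nonneg (Real.rpow_nonneg (by linarith) _), abs_neg, abs_of_nonneg (by linarith)]

/-- A symmetric property of the pairs `(a, b)` that is invariant under negation holds if it holds
for `0 ≤ b ≤ a` and for `b = -c` with `0 ≤ c ≤ a`. -/
theorem pair_induction {C : ℝ → ℝ → Prop} (hsymm : ∀ a b, C a b → C b a)
    (hneg : ∀ a b, C a b → C (-a) (-b)) (hpos : ∀ a b, 0 ≤ b → b ≤ a → C a b)
    (hopp : ∀ a c, 0 ≤ c → c ≤ a → C a (-c)) (a b : ℝ) : C a b := by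
  have key : ∀ a b, |b| ≤ a → C a b := by
    intro a b h
    rcases le_total 0 b with hb | hb
    · exact hpos a b hb ((le_abs_self b).trans h)
    · have := hopp a (-b) (by linarith) ((neg_le_abs b).trans h)
      rwa [neg_neg] at this
  have key2 : ∀ a b, |b| ≤ |a| → C a b := by
    intro a b h
    rcases le_total 0 a with ha | ha
    · exact key a b (by rwa [abs_of_nonneg ha] at h)
    · have := hneg _ _ (key (-a) (-b) (by rwa [abs_neg, ← abs_of_nonpos ha]))
      rwa [neg_neg, neg_neg] at this
  rcases le_total |b| |a| with h | h
  · exact key2 a b h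
  · exact hsymm _ _ (key2 b a h)

/-- Equal signs: superadditivity of `t ^ r`. Opposite signs: convexity, where `2 ^ (r - 1) ≤ 2`. -/
theorem half_abs_sub_rpow_le_abs_mazur_sub {r : ℝ} (hr : 1 ≤ r) (hr2 : r ≤ 2) (a b : ℝ) :
    2⁻¹ * |a - b| ^ r ≤ |mazur r a - mazur r b| := by
  have hr0 : 0 < r := by linarith
  refine pair_induction (C := fun a b => 2⁻¹ * |a - b| ^ r ≤ |mazur r a - mazur r b|)
    ?_ ?_ ?_ ?_ a b
  · intro a b h
    rwa [abs_sub_comm, abs_sub_comm (mazur r b)]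
  · intro a b h
    rwa [mazur_neg, mazur_neg, ← neg_add', ← neg_add', abs_neg, abs_neg]
  · intro a b hb hab
    rw [mazur_of_nonneg hr0 hb, mazur_of_nonneg hr0 (hb.trans hab), abs_of_nonneg (sub_nonneg.2 hab)]
    have h := Real.add_rpow_le_rpow_add (sub_nonneg.2 hab) hb hr
    rw [sub_add_cancel] at h
    have h0 : 0 ≤ (a - b) ^ r := Real.rpow_nonneg (sub_nonneg.2 hab) _
    exact le_trans (by linarith) ((le_sub_iff_add_le.2 h).trans (le_abs_self _))
  · intro a c hc hca
    rw [mazur_neg, mazur_of_nonneg hr0 hc, mazur_of_nonneg hr0 (hc.trans hca), sub_neg_eq_add,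
      sub_neg_eq_add, abs_of_nonneg (add_nonneg (hc.trans hca) hc)]
    have h : (a + c) ^ r ≤ 2 ^ (r - 1) * (a ^ r + c ^ r) := by
      have := NNReal.rpow_add_le_mul_rpow_add_rpow ⟨a, hc.trans hca⟩ ⟨c, hc⟩ hr
      exact_mod_cast this
    have h2 : (2 : ℝ) ^ (r - 1) ≤ 2 := by
      calc (2 : ℝ) ^ (r - 1) ≤ 2 ^ (1 : ℝ) := Real.rpow_le_rpow_of_exponent_le (by norm_num)
            (by linarith)
        _ = 2 := Real.rpow_one 2
    have h3 : 0 ≤ a ^ r + c ^ r := add_nonneg (Real.rpow_nonneg (hc.trans hca) _)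
      (Real.rpow_nonneg hc _)
    have h4 := mul_le_mul_of_nonneg_right h2 h3
    exact le_trans (by linarith) (le_abs_self _)

/-- The constant 1, instead of the 2 of `abs_mazur_sub_le`, matters: this bound is used at every
halving of `p`, and a 2 would turn `p ^ 4` into `p ^ 5`. -/
theorem abs_mazur_two_sub_le (a b : ℝ) :
    |mazur 2 a - mazur 2 b| ≤ 1 * (|a| + |b|) ^ ((2 : ℝ) - 1) * |a - b| := by
  have h : ((2 : ℝ) - 1) = 1 := by norm_num
  rw [h, Real.rpow_one, one_mul]
  refine pair_induction (C := fun a b => |mazur 2 a - mazur 2 b| ≤ (|a| + |b|) * |a - b|)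
    ?_ ?_ ?_ ?_ a b
  · intro a b h
    rwa [abs_sub_comm, abs_sub_comm b, add_comm]
  · intro a b h
    rwa [mazur_neg, mazur_neg, ← neg_add', ← neg_add', abs_neg, abs_neg, abs_neg, abs_neg]
  · intro a b hb hab
    have ha := hb.trans hab
    rw [mazur_of_nonneg two_pos hb, mazur_of_nonneg two_pos ha, abs_of_nonneg ha,
      abs_of_nonneg hb, abs_of_nonneg (sub_nonneg.2 hab), Real.rpow_two, Real.rpow_two,
      abs_of_nonneg (by nlinarith)]
    linarith
  · intro a c hc hca
    have ha := hc.trans hca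
    rw [mazur_neg, mazur_of_nonneg two_pos hc, mazur_of_nonneg two_pos ha, sub_neg_eq_add,
      sub_neg_eq_add, abs_neg, abs_of_nonneg ha, abs_of_nonneg hc,
      abs_of_nonneg (add_nonneg ha hc), Real.rpow_two, Real.rpow_two,
      abs_of_nonneg (by positivity)]
    nlinarith

/-- Equal signs: Bernoulli's inequality, with `r ≤ 2`. Opposite signs: superadditivity of `t ^ r`.
-/
theorem abs_mazur_sub_le {r : ℝ} (hr : 1 ≤ r) (hr2 : r ≤ 2) (a b : ℝ) :
    |mazur r a - mazur r b| ≤ 2 * (|a| + |b|) ^ (r - 1) * |a - b| := by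
  have hr0 : 0 < r := by linarith
  refine pair_induction
    (C := fun a b => |mazur r a - mazur r b| ≤ 2 * (|a| + |b|) ^ (r - 1) * |a - b|) ?_ ?_ ?_ ?_ a b
  · intro a b h
    rwa [abs_sub_comm, abs_sub_comm b, add_comm]
  · intro a b h
    rwa [mazur_neg, mazur_neg, ← neg_add', ← neg_add', abs_neg, abs_neg, abs_neg, abs_neg]
  · intro a b hb hab
    rcases (hb.trans hab).eq_or_lt with rfl | ha
    · have : b = 0 := le_antisymm hab hb
      subst this
      simp
    rw [mazur_of_nonneg hr0 hb, mazur_of_nonneg hr0 ha.le, abs_of_nonneg ha.le,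
      abs_of_nonneg hb, abs_of_nonneg (sub_nonneg.2 hab),
      abs_of_nonneg (sub_nonneg.2 (Real.rpow_le_rpow hb hab hr0.le))]
    have h1 := one_add_mul_self_le_rpow_one_add (s := b / a - 1)
      (by have : 0 ≤ b / a := by positivity
          linarith) hr
    rw [add_sub_cancel, Real.div_rpow hb ha.le] at h1
    have hpow : a ^ r = a ^ (r - 1) * a := by
      rw [Real.rpow_sub_one ha.ne', div_mul_cancel₀ _ ha.ne']
    have har : 0 < a ^ r := by positivity
    have h2 : a ^ r - b ^ r ≤ r * a ^ (r - 1) * (a - b) := by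
      rw [le_div_iff₀ har] at h1
      have : (1 + r * (b / a - 1)) * a ^ r = a ^ r - r * a ^ (r - 1) * (a - b) := by
        rw [hpow]; field_simp; ring
      linarith
    refine h2.trans ?_
    have : 0 ≤ a - b := sub_nonneg.2 hab
    have h5 : a ^ (r - 1) ≤ (a + b) ^ (r - 1) :=
      Real.rpow_le_rpow ha.le (by linarith) (by linarith)
    gcongr
  · intro a c hc hca
    have ha := hc.trans hca
    have hac : 0 ≤ a + c := add_nonneg ha hc
    rw [mazur_neg, mazur_of_nonneg hr0 hc, mazur_of_nonneg hr0 ha, sub_neg_eq_add,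
      sub_neg_eq_add, abs_neg, abs_of_nonneg ha, abs_of_nonneg hc, abs_of_nonneg hac,
      abs_of_nonneg (add_nonneg (Real.rpow_nonneg ha _) (Real.rpow_nonneg hc _))]
    refine (Real.add_rpow_le_rpow_add ha hc hr).trans ?_
    rcases hac.eq_or_lt with h | h
    · rw [← h, Real.zero_rpow hr0.ne']; simp
    · have : (a + c) ^ r = (a + c) ^ (r - 1) * (a + c) := by
        rw [Real.rpow_sub_one h.ne', div_mul_cancel₀ _ h.ne']
      have h0 : 0 ≤ (a + c) ^ r := by positivity
      rw [mul_assoc, ← this]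
      linarith

theorem summable_abs_mazur_rpow {p r : ℝ} (hr : 0 < r) {a : ℕ → ℝ}
    (ha : Summable fun k => |a k| ^ p) : Summable fun k => |mazur r (a k)| ^ (p / r) := by
  refine ha.congr fun k => ?_
  rw [abs_mazur hr, ← Real.rpow_mul (abs_nonneg _), mul_div_cancel₀ _ hr.ne']

theorem half_seqDist_rpow_le_seqDist_mazur {p r : ℝ} (hr : 1 ≤ r) (hr2 : r ≤ 2) (hpr : r ≤ p)
    {a b : ℕ → ℝ} (ha : Summable fun k => |a k| ^ p) (hb : Summable fun k => |b k| ^ p) :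
    2⁻¹ * seqDist p a b ^ r ≤
      seqDist (p / r) (fun k => mazur r (a k)) (fun k => mazur r (b k)) := by
  have hr0 : 0 < r := by linarith
  have hp0 : 0 < p := by linarith
  have hq : 1 ≤ p / r := (one_le_div hr0).2 hpr
  have hq0 : 0 < p / r := by positivity
  have hS : 0 ≤ ∑' k, |a k - b k| ^ p := tsum_nonneg fun _ => by positivity
  have h1 : (2⁻¹ : ℝ) ^ (p / r) * ∑' k, |a k - b k| ^ p ≤
      ∑' k, |mazur r (a k) - mazur r (b k)| ^ (p / r) := by
    rw [← tsum_mul_left]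
    refine Summable.tsum_le_tsum (fun k => ?_)
      ((summable_abs_sub_rpow (hr.trans hpr) ha hb).mul_left _)
      (summable_abs_sub_rpow hq (summable_abs_mazur_rpow hr0 ha) (summable_abs_mazur_rpow hr0 hb))
    calc _ = (2⁻¹ * |a k - b k| ^ r) ^ (p / r) := by
          rw [Real.mul_rpow (by norm_num) (by positivity), ← Real.rpow_mul (abs_nonneg _),
            mul_div_cancel₀ _ hr0.ne']
      _ ≤ _ := by
        gcongr
        exact half_abs_sub_rpow_le_abs_mazur_sub hr hr2 _ _
  unfold seqDist
  calc _ = ((2⁻¹ : ℝ) ^ (p / r) * ∑' k, |a k - b k| ^ p) ^ (1 / (p / r)) := by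
        rw [Real.mul_rpow (by positivity) hS, ← Real.rpow_mul (x := (2⁻¹ : ℝ)) (by norm_num),
          mul_one_div_cancel hq0.ne', Real.rpow_one, ← Real.rpow_mul hS]
        congr 2
        field_simp
    _ ≤ _ := by gcongr

/-- Hölder with `(r - 1)/p + 1/p = r/p` applied to the pointwise bound `hK`; Minkowski bounds the
norm of `|a| + |b|` by `2R`. -/
theorem seqDist_mazur_le {p r K R : ℝ} (hr : 1 < r) (hpr : r ≤ p) (hK0 : 0 ≤ K)
    (hK : ∀ a b, |mazur r a - mazur r b| ≤ K * (|a| + |b|) ^ (r - 1) * |a - b|)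
    {a b : ℕ → ℝ} (ha : Summable fun k => |a k| ^ p) (hb : Summable fun k => |b k| ^ p)
    (haR : (∑' k, |a k| ^ p) ^ (1 / p) ≤ R) (hbR : (∑' k, |b k| ^ p) ^ (1 / p) ≤ R) :
    seqDist (p / r) (fun k => mazur r (a k)) (fun k => mazur r (b k)) ≤
      K * (2 * R) ^ (r - 1) * seqDist p a b := by
  have hr0 : 0 < r := by linarith
  have hr1 : 0 < r - 1 := by linarith
  have hp0 : 0 < p := by linarith
  have hp1 : 1 ≤ p := by linarith
  have hq : 1 ≤ p / r := (one_le_div hr0).2 hpr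
  have hq0 : 0 < p / r := by positivity
  have hab := summable_abs_sub_rpow hp1 ha hb
  obtain ⟨hs, hs'⟩ := Real.Lp_add_le_tsum_of_nonneg hp1 (fun k => abs_nonneg (a k))
    (fun k => abs_nonneg (b k)) ha hb
  have hpow : ∀ k, ((|a k| + |b k|) ^ (r - 1)) ^ (p / (r - 1)) = (|a k| + |b k|) ^ p := by
    intro k
    rw [← Real.rpow_mul (by positivity), mul_div_cancel₀ _ hr1.ne']
  have htriple : (p / (r - 1)).HolderTriple p (p / r) :=
    ⟨by field_simp; ring, by positivity, hp0⟩
  have hsum : Summable fun k => ((|a k| + |b k|) ^ (r - 1)) ^ (p / (r - 1)) := by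
    simpa only [hpow] using hs
  have hH := Real.Lr_le_Lp_mul_Lq_tsum_of_nonneg htriple
    (f := fun k => (|a k| + |b k|) ^ (r - 1)) (g := fun k => |a k - b k|)
    (fun k => by positivity) (fun k => abs_nonneg _) hsum hab
  have hHs := Real.summable_Lr_of_Lp_Lq_of_nonneg htriple
    (f := fun k => (|a k| + |b k|) ^ (r - 1)) (g := fun k => |a k - b k|)
    (fun k => by positivity) (fun k => abs_nonneg _) hsum hab
  simp only [hpow] at hH
  have hT : 0 ≤ ∑' k, (|a k| + |b k|) ^ p := tsum_nonneg fun _ => by positivity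
  have hU : 0 ≤ ∑' k, ((|a k| + |b k|) ^ (r - 1) * |a k - b k|) ^ (p / r) :=
    tsum_nonneg fun _ => by positivity
  have h1 : ∑' k, |mazur r (a k) - mazur r (b k)| ^ (p / r) ≤
      K ^ (p / r) * ∑' k, ((|a k| + |b k|) ^ (r - 1) * |a k - b k|) ^ (p / r) := by
    rw [← tsum_mul_left]
    refine Summable.tsum_le_tsum (fun k => ?_) (summable_abs_sub_rpow hq
      (summable_abs_mazur_rpow hr0 ha) (summable_abs_mazur_rpow hr0 hb)) (hHs.mul_left _)
    rw [← Real.mul_rpow hK0 (by positivity), ← mul_assoc]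
    gcongr
    exact hK _ _
  have h2 : (∑' k, (|a k| + |b k|) ^ p) ^ (1 / (p / (r - 1))) ≤ (2 * R) ^ (r - 1) := by
    calc _ = ((∑' k, (|a k| + |b k|) ^ p) ^ (1 / p)) ^ (r - 1) := by
          rw [← Real.rpow_mul hT]
          congr 1
          field_simp
      _ ≤ _ := by
        gcongr
        linarith
  unfold seqDist
  calc _ ≤ (K ^ (p / r) *
        ∑' k, ((|a k| + |b k|) ^ (r - 1) * |a k - b k|) ^ (p / r)) ^ (1 / (p / r)) := by
        gcongr
    _ = K * (∑' k, ((|a k| + |b k|) ^ (r - 1) * |a k - b k|) ^ (p / r)) ^ (1 / (p / r)) := by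
      rw [Real.mul_rpow (by positivity) hU, ← Real.rpow_mul hK0, mul_one_div_cancel hq0.ne',
        Real.rpow_one]
    _ ≤ K * ((∑' k, (|a k| + |b k|) ^ p) ^ (1 / (p / (r - 1))) *
        (∑' k, |a k - b k| ^ p) ^ (1 / p)) := by gcongr
    _ ≤ K * ((2 * R) ^ (r - 1) * (∑' k, |a k - b k| ^ p) ^ (1 / p)) := by
      gcongr
    _ = _ := by ring

/-! ### Transfer from `ℓ_{p/r}` to `ℓ_p` by descent through scales. -/

/-- Refining every cluster of a random partition by a further random partition. -/
theorem PMF.toOuterMeasure_bind_inf_le {ι : Type*} (D : PMF (Setoid ι))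
    (F : Setoid ι → PMF (Setoid ι)) (i j : ι) (c : ℝ≥0∞)
    (hF : ∀ P ∈ D.support, P i j → (F P).toOuterMeasure {Q | ¬ Q i j} ≤ c) :
    (D.bind fun P => (F P).map fun Q => P ⊓ Q).toOuterMeasure {P | ¬ P i j} ≤
      D.toOuterMeasure {P | ¬ P i j} + c := by
  rw [PMF.toOuterMeasure_bind_apply, PMF.toOuterMeasure_apply]
  calc _ ≤ ∑' P, (Set.indicator {P : Setoid ι | ¬ P i j} D P + D P * c) := by
        refine ENNReal.tsum_le_tsum fun P => ?_
        by_cases hP : P i j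
        · by_cases hD : P ∈ D.support
          · refine le_add_left ?_
            gcongr
            rw [PMF.toOuterMeasure_map_apply]
            have : ((fun Q => P ⊓ Q) ⁻¹' {P | ¬ P i j}) = {Q : Setoid ι | ¬ Q i j} := by
              ext Q
              exact not_congr ⟨And.right, And.intro hP⟩
            rw [this]
            exact hF P hD hP
          · rw [PMF.mem_support_iff, not_not] at hD
            simp [hD]
        · refine le_add_right ?_
          rw [Set.indicator_of_mem (show P ∈ {P : Setoid ι | ¬ P i j} from hP)]
          exact mul_le_of_le_one_right' (PMF.toOuterMeasure_le_one _ _)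
    _ = _ := by rw [ENNReal.tsum_add, ENNReal.tsum_mul_right, D.tsum_coe, one_mul]

/-- Passing from `ℓ_{p/r}` to `ℓ_p`: the clusters of a decomposition at scale `2 Δ` are mapped
into `ℓ_{p/r}` by Mazur maps and decomposed there. -/
theorem SeqDecomposable.of_mazur {p r K β : ℝ} {n : ℕ} (hr : 1 < r) (hr2 : r ≤ 2) (hpr : r ≤ p)
    (hK0 : 0 ≤ K)
    (hK : ∀ a b, |mazur r a - mazur r b| ≤ K * (|a| + |b|) ^ (r - 1) * |a - b|) (hβ : 0 ≤ β)
    (h : SeqDecomposable (p / r) n β) :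
    SeqDecomposable p n (2 * (2 * K * 4 ^ (r - 1) * β)) := by
  intro ι _ hι x hx Δ hΔ
  have hr0 : 0 < r := by linarith
  have hp1 : 1 ≤ p := by linarith
  set B := 2 * K * 4 ^ (r - 1) * β with hB
  have hB0 : 0 ≤ B := by positivity
  obtain ⟨m, hm⟩ : ∃ m : ℕ, ∀ i j, seqDist p (x i) (x j) ≤ 2 ^ m * Δ := by
    obtain ⟨C, hC⟩ := (Set.finite_range fun ij : ι × ι => seqDist p (x ij.1) (x ij.2)).bddAbove
    obtain ⟨m, hm⟩ := pow_unbounded_of_one_lt (C / Δ) (one_lt_two (α := ℝ))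
    refine ⟨m, fun i j => (hC ⟨(i, j), rfl⟩).trans ?_⟩
    rw [div_lt_iff₀ hΔ] at hm
    exact hm.le
  induction m generalizing Δ with
  | zero =>
    refine ⟨PMF.pure ⊤, fun P _ i j _ => by simpa using hm i j, fun i j => ?_⟩
    rw [PMF.toOuterMeasure_pure_apply, if_neg]
    · exact zero_le
    · exact fun h => h trivial
  | succ m ih =>
    obtain ⟨D, hD, hD'⟩ := ih (2 * Δ) (by positivity) fun i j => (hm i j).trans (by
      rw [pow_succ]; linarith)
    -- `c P i` is a centre of the cluster of `i`. Subtracting it moves the cluster into the ball of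
    -- radius `2Δ` about 0 and keeps the distances inside the cluster.
    let c : Setoid ι → ι → ι := fun P i => (Quotient.mk P i).out
    have hc : ∀ (P : Setoid ι) i, P i (c P i) := fun P i =>
      P.symm (Quotient.exact (Quotient.out_eq (Quotient.mk P i)))
    have hc' : ∀ (P : Setoid ι) i j, P i j → c P i = c P j := fun P i j hij =>
      congrArg Quotient.out (Quotient.sound hij)
    let y : Setoid ι → ι → ℕ → ℝ := fun P i k => x i k - x (c P i) k
    have hy : ∀ P i, Summable fun k => |y P i k| ^ p := fun P i =>
      summable_abs_sub_rpow hp1 (hx i) (hx _)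
    have hyd : ∀ P i j, P i j → seqDist p (y P i) (y P j) = seqDist p (x i) (x j) := by
      intro P i j hij
      simp only [seqDist, y, hc' P i j hij, sub_sub_sub_cancel_right]
    -- By `half_seqDist_rpow_le_seqDist_mazur`, image distance at most `2⁻¹ * Δ ^ r` forces original
    -- distance at most `Δ`.
    have hΔ' : 0 < 2⁻¹ * Δ ^ r := by positivity
    have hrec := fun P => h ι hι (fun i k => mazur r (y P i k))
      (fun i => summable_abs_mazur_rpow hr0 (hy P i)) (2⁻¹ * Δ ^ r) hΔ'
    choose F hF hF' using hrec
    refine ⟨D.bind fun P => (F P).map fun Q => P ⊓ Q, ?_, fun i j => ?_⟩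
    · intro P' hP' i j hij
      rw [PMF.mem_support_bind_iff] at hP'
      obtain ⟨P, hP, hP'⟩ := hP'
      rw [PMF.mem_support_map_iff] at hP'
      obtain ⟨Q, hQ, rfl⟩ := hP'
      obtain ⟨h1, h2⟩ : P i j ∧ Q i j := hij
      have h3 := (half_seqDist_rpow_le_seqDist_mazur hr.le hr2 hpr (hy P i) (hy P j)).trans
        (hF P Q hQ i j h2)
      rw [hyd P i j h1] at h3
      have h4 := le_of_mul_le_mul_left h3 (by norm_num)
      exact (Real.rpow_le_rpow_iff (seqDist_nonneg _ _ _) hΔ.le hr0).1 h4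
    · set d := seqDist p (x i) (x j) with hd
      have hd0 : 0 ≤ d := seqDist_nonneg _ _ _
      refine (PMF.toOuterMeasure_bind_inf_le D F i j (ENNReal.ofReal (B * (d / Δ))) ?_).trans ?_
      · intro P hP hij
        refine (hF' P i j).trans (ENNReal.ofReal_le_ofReal ?_)
        have h1 := seqDist_mazur_le hr hpr hK0 hK (hy P i) (hy P j)
          (hD P hP i (c P i) (hc P i)) (hD P hP j (c P j) (hc P j))
        rw [hyd P i j hij, ← hd] at h1
        calc _ ≤ β * (K * (2 * (2 * Δ)) ^ (r - 1) * d / (2⁻¹ * Δ ^ r)) := by gcongr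
          _ = B * (d / Δ) := by
            rw [show 2 * (2 * Δ) = 4 * Δ by ring, Real.mul_rpow (by norm_num) hΔ.le,
              Real.rpow_sub_one hΔ.ne', hB]
            have : 0 < Δ ^ r := by positivity
            field_simp
      -- The parameter `2 * B` reproduces itself: scale `2Δ` contributes `B d / Δ`, and the
      -- refinement the same again.
      · calc _ ≤ ENNReal.ofReal (2 * B * (d / (2 * Δ))) + ENNReal.ofReal (B * (d / Δ)) := by
              gcongr
              exact hD' i j
          _ = _ := by
            rw [← ENNReal.ofReal_add (by positivity) (by positivity)]
            congr 1
            field_simp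
            ring

theorem SeqDecomposable.mono {p β β' : ℝ} {n : ℕ} (hβ : β ≤ β') (h : SeqDecomposable p n β) :
    SeqDecomposable p n β' := by
  intro ι _ hι x hx Δ hΔ
  obtain ⟨D, h1, h2⟩ := h ι hι x hx Δ hΔ
  refine ⟨D, h1, fun i j => (h2 i j).trans (ENNReal.ofReal_le_ofReal ?_)⟩
  have := seqDist_nonneg p (x i) (x j)
  gcongr

/-! ### Iteration over the exponent and conclusion. -/

theorem seqDecomposable_of_two_le_of_le_four {p : ℝ} (hp : 2 ≤ p) (hp4 : p ≤ 4) {n : ℕ}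
    (hn : 2 ≤ n) : SeqDecomposable p n (1024 * √(Real.log n)) := by
  have hs : 0 ≤ √(Real.log n) := Real.sqrt_nonneg _
  rcases hp.eq_or_lt with rfl | hp
  · exact (seqDecomposable_two hn).mono (by linarith)
  -- The map with `r = p / 2` lands in `ℓ_2`; the case `p = 2` is separate because `r > 1` is
  -- needed.
  · have h2 : p / (p / 2) = 2 := by field_simp
    have h := SeqDecomposable.of_mazur (p := p) (r := p / 2) (K := 2) (n := n)
      (β := 32 * √(Real.log n)) (by linarith) (by linarith) (by linarith) (by norm_num)
      (abs_mazur_sub_le (by linarith) (by linarith)) (by positivity)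
      (by rw [h2]; exact seqDecomposable_two hn)
    refine h.mono ?_
    have h4 : (4 : ℝ) ^ (p / 2 - 1) ≤ 4 := by
      calc (4 : ℝ) ^ (p / 2 - 1) ≤ 4 ^ (1 : ℝ) := Real.rpow_le_rpow_of_exponent_le (by norm_num)
            (by linarith)
        _ = 4 := Real.rpow_one 4
    calc _ = 256 * √(Real.log n) * (4 : ℝ) ^ (p / 2 - 1) := by ring
      _ ≤ 256 * √(Real.log n) * 4 := by gcongr
      _ = _ := by ring

theorem seqDecomposable_of_two_le {n : ℕ} (hn : 2 ≤ n) {p : ℝ} (hp : 2 ≤ p) :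
    SeqDecomposable p n (1024 * p ^ 4 * √(Real.log n)) := by
  have hs : 0 ≤ √(Real.log n) := Real.sqrt_nonneg _
  -- After `m` halvings the exponent is in `[2, 4)`; each costs `2 * (2 * 1 * 4) = 16`.
  have H : ∀ m : ℕ, ∀ p : ℝ, 2 ^ m ≤ p / 2 → p / 2 < 2 ^ (m + 1) →
      SeqDecomposable p n (1024 * 16 ^ m * √(Real.log n)) := by
    intro m
    induction m with
    | zero =>
      intro p h1 h2
      norm_num at h1 h2
      simpa using seqDecomposable_of_two_le_of_le_four (p := p) (by linarith) (by linarith) hn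
    | succ m ih =>
      intro p h1 h2
      have hm : (1 : ℝ) ≤ 2 ^ m := one_le_pow₀ one_le_two
      rw [pow_succ] at h1
      rw [pow_succ] at h2
      have h := SeqDecomposable.of_mazur (p := p) one_lt_two le_rfl (by linarith) zero_le_one
        abs_mazur_two_sub_le (by positivity) (ih (p / 2) (by linarith) (by linarith))
      refine h.mono (le_of_eq ?_)
      rw [show (2 : ℝ) - 1 = 1 by norm_num, Real.rpow_one]
      ring
  obtain ⟨m, h1, h2⟩ := exists_nat_pow_near (x := p / 2) (by linarith) (one_lt_two (α := ℝ))
  refine (H m p h1 h2).mono ?_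
  have h16 : (16 : ℝ) ^ m ≤ p ^ 4 := by
    calc (16 : ℝ) ^ m = (2 ^ m) ^ 4 := by rw [← pow_mul, mul_comm, pow_mul]; norm_num
      _ ≤ p ^ 4 := by gcongr; linarith
  gcongr

theorem mainTheorem2 :
    ∃ K : ℝ, 0 < K ∧ ∀ (p : ℝ≥0∞) [Fact (1 ≤ p)], 2 ≤ p → p ≠ ∞ → ∀ n : ℕ, 2 ≤ n →
      finiteDecompositionParameter n (lp (fun _ : ℕ => ℝ) p) ≤
        ENNReal.ofReal (K * p.toReal ^ 4 * Real.sqrt (Real.log n)) := by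
  refine ⟨1024, by norm_num, ?_⟩
  intro p _ hp2 hptop n hn
  have hp : 2 ≤ p.toReal := by
    simpa using (ENNReal.toReal_le_toReal (by simp) hptop).2 hp2
  have hp0 : 0 < p.toReal := by linarith
  refine iSup₂_le fun S hS => ?_
  refine iInf₂_le_of_le (1024 * p.toReal ^ 4 * √(Real.log n)) ⟨?_, ?_⟩ le_rfl
  -- Admissibility requires a parameter of at least 1; `log 2 > 1/4` suffices.
  · have hlog : 1 / 2 ≤ √(Real.log n) := by
      refine Real.le_sqrt_of_sq_le ?_
      have h2 : Real.log 2 ≤ Real.log n := Real.log_le_log (by norm_num) (by exact_mod_cast hn)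
      have := Real.log_two_gt_d9
      norm_num at this ⊢
      linarith
    have h4 : (2 : ℝ) ^ 4 ≤ p.toReal ^ 4 := by gcongr
    nlinarith
  · intro Δ hΔ T hT
    have : Fintype T := hT.fintype
    have hcard : Fintype.card T ≤ n := by
      have h1 : T.encard ≤ (n : ℕ∞) := by
        calc T.encard = (Subtype.val '' T).encard :=
              (Subtype.val_injective.encard_image T).symm
          _ ≤ S.encard := Set.encard_le_encard (Subtype.coe_image_subset S T)
          _ ≤ n := hS
      rw [Set.encard_eq_coe_toFinset_card, Set.toFinset_card] at h1
      exact_mod_cast h1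
    obtain ⟨D, h1, h2⟩ := seqDecomposable_of_two_le hn hp T hcard
      (fun i => ((i : S) : lp (fun _ : ℕ => ℝ) p))
      (fun i => by simpa using (lp.memℓp ((i : S) : lp (fun _ : ℕ => ℝ) p)).summable hp0) Δ hΔ
    have hdist : ∀ i j : T, dist i j = seqDist p.toReal ((i : S) : lp (fun _ : ℕ => ℝ) p)
        ((j : S) : lp (fun _ : ℕ => ℝ) p) := fun i j => by
      rw [← lp.norm_sub_eq_seqDist hp0, ← dist_eq_norm]
      rfl
    simp only [← hdist] at h1 h2
    refine ⟨D, ?_, h2⟩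
    rintro P hP C ⟨c, rfl⟩
    refine Metric.ediam_le fun i hi j hj => ?_
    rw [edist_dist]
    exact ENNReal.ofReal_le_ofReal (h1 P hP i j (P.trans hi (P.symm hj)))
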